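/- Let $\alpha\in\mathbb R$ and $d\in\mathbb N$. Write $\mathscr P(\mathbb R^d)$ for the set of all probability distributions on $\mathbb R^d$, $I(\mathbb R^d)$ for the set of the infinitely divisible ones, and $\widehat\mu(z)$ for the characteristic function of $\mu$. For $\mu\in I(\mathbb R^d)$ let $C_\mu$ be the unique continuous function with $C_\mu(0)=0$ and $\widehat\mu=e^{C_\mu}$; for $t>0$ put $\widehat\mu(z)^t:=e^{tC_\mu(z)}$, and let the $t$-th convolution $\mu^t$ of $\mu$ be the distribution with characteristic function $\widehat\mu(z)^t$. A set $H\subset I(\mathbb R^d)$ is called *completely closed in the strong sense* if it is closed under convolution, under weak convergence, under type equivalence (if the law of $X$ is in $H$, then so is the law of $aX+c$ for all $a>0$, $c\in\mathbb R^d$), and under $t$-th convolution for every $t>0$. For $H\subset I(\mathbb R^d)$ let $\mathfrak Q_\alpha(H)$ be the set of all $\mu\in\mathscr P(\mathbb R^d)$ for which there are $\mu_j\in I(\mathbb R^d)$ ($j\in\{1,2,\dots\}$) with $\mu_j\in H$ for all $j\ge j_0$, for some $j_0\ge 1$, a nondecreasing sequence $a_n>0$ with $a_n\to\infty$ and $a_{n+1}/a_n\to1$,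 vectors $c_n\in\mathbb R^d$, and $p_n>0$ with $p_n/a_n^\alpha\to1$, such that $$\lim_{n\to\infty}\ \prod_{j=1}^n\widehat\mu_j(a_n^{-1}z)^{p_n}\,e^{i\langle c_n,z\rangle}=\widehat\mu(z)\qquad\text{for all } z\in\mathbb R^d .$$ Let $L^{\langle\alpha\rangle}(\mathbb R^d)$ be the set of all $\alpha$-selfdecomposable distributions, that is, of all $\mu\in I(\mathbb R^d)$ such that for every $b>1$ there is $\rho_b\in I(\mathbb R^d)$ with $$\widehat\mu(z)=\widehat\mu(b^{-1}z)^{b^\alpha}\,\widehat\rho_b(z)\qquad\text{for all } z\in\mathbb R^d.\tag{1}$$ Then: (i) For every $H\subset I(\mathbb R^d)$ that is completely closed in the strong sense and every $\mu\in\mathscr P(\mathbb R^d)$: $\mu\in\mathfrak Q_\alpha(H)$ if and only if $\mu\in I(\mathbb R^d)$ and for every $b>1$ there is $\rho_b\in H$ satisfying (1). (ii) $\mathfrak Q_\alpha(I(\mathbb R^d))=L^{\langle\alpha\rangle}(\mathbb R^d)$. -/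

import Mathlib

open MeasureTheory Filter Topology

noncomputable section

namespace AlphaSD

/-- Euclidean space `ℝ^d`. -/
abbrev Rd (d : ℕ) : Type := EuclideanSpace ℝ (Fin d)

/-- The class of all probability distributions on `ℝ^d` (with the topology of weak convergence). -/
abbrev Pr (d : ℕ) : Type := ProbabilityMeasure (Rd d)

/-- The characteristic function `z ↦ ∫ exp (i ⟨x, z⟩) μ(dx)`. -/
def cf {d : ℕ} (μ : Pr d) (z : Rd d) : ℂ := charFun (μ : Measure (Rd d)) z

/-- The `n`-fold convolution of `μ` with itself; the `0`-fold one is the point mass at `0`. -/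
def nConv {d : ℕ} (μ : Measure (Rd d)) : ℕ → Measure (Rd d)
  | 0 => Measure.dirac 0
  | n + 1 => Measure.conv (nConv μ n) μ

/-- The class `I(ℝ^d)` of infinitely divisible distributions: for every `n ≥ 1`, `μ` is the `n`-fold
convolution of some probability distribution. -/
def ID (d : ℕ) : Set (Pr d) :=
  {μ | ∀ n : ℕ, 1 ≤ n → ∃ ν : Pr d, nConv (ν : Measure (Rd d)) n = (μ : Measure (Rd d))}

/-- `C` is a continuous logarithm of the characteristic function of `μ` that vanishes at `0`. -/
def IsCumulant {d : ℕ} (μ : Pr d) (C : Rd d → ℂ) : Prop :=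
  Continuous C ∧ C 0 = 0 ∧ ∀ z, cf μ z = Complex.exp (C z)

open Classical in
/-- The cumulant function `C_μ`: the continuous function with `C_μ 0 = 0` and `cf μ = exp ∘ C_μ`.
It exists and is unique for every infinitely divisible `μ`; the value `0` is used for those `μ`
without a continuous logarithm. -/
def cumulant {d : ℕ} (μ : Pr d) : Rd d → ℂ :=
  if h : ∃ C : Rd d → ℂ, IsCumulant μ C then h.choose else 0

theorem IsCumulant.unique {d : ℕ} {μ : Pr d} {C D : Rd d → ℂ}
    (hC : IsCumulant μ C) (hD : IsCumulant μ D) : C = D := by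
  obtain ⟨hC, hC0, hCe⟩ := hC
  obtain ⟨hD, hD0, hDe⟩ := hD
  have h2 : ∀ z, ∃ n : ℤ, C z - D z = n * (2 * Real.pi * Complex.I) := fun z => by
    rw [← Complex.exp_eq_one_iff, Complex.exp_sub, ← hCe, ← hDe, div_self]
    rw [hDe]; exact Complex.exp_ne_zero _
  choose n hn using h2
  have hc : Continuous (fun z => ((n z : ℤ) : ℝ)) := by
    have : (fun z => ((n z : ℤ) : ℝ)) = fun z => ((C z - D z) / (2 * Real.pi * Complex.I)).re := by
      funext z
      rw [hn z, mul_div_assoc, div_self Complex.two_pi_I_ne_zero]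
      simp
    rw [this]
    fun_prop
  have hc' : Continuous n := Int.isClosedEmbedding_coe_real.isEmbedding.continuous_iff.2 hc
  funext z
  have h0 : n z = n 0 := PreconnectedSpace.constant inferInstance hc'
  have h00 := hn 0
  rw [← h0, ← hn z, hC0, hD0, sub_self] at h00
  exact sub_eq_zero.1 h00.symm

theorem cumulant_eq {d : ℕ} {μ : Pr d} {C : Rd d → ℂ} (h : IsCumulant μ C) : cumulant μ = C := by
  have : ∃ C : Rd d → ℂ, IsCumulant μ C := ⟨C, h⟩
  rw [cumulant, dif_pos this]
  exact this.choose_spec.unique h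

/-- The real power `cf μ z ^ t := exp (t * C_μ z)` of the characteristic function. -/
def cfPow {d : ℕ} (μ : Pr d) (t : ℝ) (z : Rd d) : ℂ :=
  Complex.exp ((t : ℂ) * cumulant μ z)

/-- `ν` is the `t`-th convolution of `μ`, the distribution with characteristic function
`z ↦ cf μ z ^ t`. -/
def IsConvPow {d : ℕ} (μ : Pr d) (t : ℝ) (ν : Pr d) : Prop :=
  ∀ z, cf ν z = cfPow μ t z

/-- `H ⊆ I(ℝ^d)` is completely closed in the strong sense: closed under convolution, weak
convergence, type equivalence, and `t`-th convolution for every `t > 0`. -/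
structure CCSS {d : ℕ} (H : Set (Pr d)) : Prop where
  subset_ID : H ⊆ ID d
  conv_mem : ∀ μ ∈ H, ∀ ν ∈ H, ∀ ρ : Pr d,
    (ρ : Measure (Rd d)) = Measure.conv (μ : Measure (Rd d)) (ν : Measure (Rd d)) → ρ ∈ H
  lim_mem : ∀ (u : ℕ → Pr d) (μ : Pr d), (∀ n, u n ∈ H) → Tendsto u atTop (𝓝 μ) → μ ∈ H
  type_mem : ∀ μ ∈ H, ∀ (a : ℝ) (c : Rd d), 0 < a → ∀ ρ : Pr d,
    (ρ : Measure (Rd d)) = Measure.map (fun x => a • x + c) (μ : Measure (Rd d)) → ρ ∈ H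
  convPow_mem : ∀ μ ∈ H, ∀ t : ℝ, 0 < t → ∀ ρ : Pr d, IsConvPow μ t ρ → ρ ∈ H

/-- The class `𝔔_α(H)` of limits of normalized partial products. The sequences are indexed by
`1, 2, 3, …`; their entries at index `0` play no role. -/
def Q {d : ℕ} (α : ℝ) (H : Set (Pr d)) : Set (Pr d) :=
  {μ | ∃ (u : ℕ → Pr d) (a p : ℕ → ℝ) (c : ℕ → Rd d),
    (∀ j, 1 ≤ j → u j ∈ ID d) ∧
    (∃ j₀, 1 ≤ j₀ ∧ ∀ j, j₀ ≤ j → u j ∈ H) ∧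
    (∀ n, 1 ≤ n → 0 < a n) ∧
    MonotoneOn a (Set.Ici 1) ∧
    Tendsto a atTop atTop ∧
    Tendsto (fun n => a (n + 1) / a n) atTop (𝓝 1) ∧
    (∀ n, 1 ≤ n → 0 < p n) ∧
    Tendsto (fun n => p n / a n ^ α) atTop (𝓝 1) ∧
    ∀ z : Rd d, Tendsto
      (fun n => (∏ j ∈ Finset.Icc 1 n, cfPow (u j) (p n) ((a n)⁻¹ • z)) *
        Complex.exp (Complex.I * (inner ℝ (c n) z : ℝ))) atTop (𝓝 (cf μ z))}

/-- The decomposition `cf μ z = cf μ (b⁻¹ z) ^ (b ^ α) * cf ρ z` for all `z`. -/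
def Decomp {d : ℕ} (α b : ℝ) (μ ρ : Pr d) : Prop :=
  ∀ z : Rd d, cf μ z = cfPow μ (b ^ α) (b⁻¹ • z) * cf ρ z

/-- The class `L^⟨α⟩(ℝ^d)` of `α`-selfdecomposable distributions. -/
def L (d : ℕ) (α : ℝ) : Set (Pr d) :=
  {μ | μ ∈ ID d ∧ ∀ b : ℝ, 1 < b → ∃ ρ ∈ ID d, Decomp α b μ ρ}

end AlphaSD

end

/-!
The theorem is a statement about the cumulants `C_μ = cumulant μ`. In these terms the decomposition
with parameter `b` reads `C_ρ(z) = C_μ(z) - b ^ α * C_μ(b⁻¹ z)`, and the `n`-th normalized partial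
product has the cumulant `Γ_n(z) = p_n ∑_{j ≤ n} C_j(a_n⁻¹ z) + i ⟨c_n, z⟩` (`partialCumulant`).

*Limits are decomposable* (`mem_ID_and_decomp_of_mem_Q`). Since `a_n → ∞` and `a_{n+1} / a_n → 1`,
there are indices `m(n) > n` with `a_{m(n)} / a_n → b` (`exists_index_ratio_tendsto`); then also
`p_{m(n)} / p_n → b ^ α`. By `partialCumulant_sub`, the difference
`Γ_{m(n)}(z) - (p_{m(n)} / p_n) Γ_n((a_n / a_{m(n)}) z)` involves only the factors with indices in
`(n, m(n)]`, hence is the cumulant of a law in `H`. It converges to `C_μ(z) - b ^ α * C_μ(b⁻¹ z)`,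
and Lévy's continuity theorem turns this limit into the cumulant of some `ρ ∈ H`.

*Decomposable laws are limits* (`mem_Q_of_decomp`). Put `a_n = n`, `p_n = n ^ α`, `c_n = 0` and
`D_j(w) = j ^ (-α) * C_μ(j w)`. The decomposition with `b = j / (j - 1)` says exactly that
`D_j - D_{j-1}` is the cumulant of a law in `H`, namely of a rescaled convolution power of `ρ_b`.
These increments telescope, and the `n`-th normalized product is equal to `μ` for every `n ≥ 1`.

What these arguments need about infinitely divisible laws is proved first. Their characteristic
functions `f` satisfy `1 - |f(2z)| ^ (2/n) ≤ 4 (1 - |f(z)| ^ (2/n))` for all `n`, a condition that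
survives pointwise limits and forces `f` to have no zeros (`DoublingBound`), so that cumulants
exist. Weak convergence implies locally uniform convergence of the cumulants
(`tendsto_cumulant_prod`). Consequently roots and real powers of infinitely divisible laws exist as
limits (`mem_ID_of_tendsto`, `exists_isConvPow`), and `I(ℝ^d)` is itself completely closed in the
strong sense (`ccss_ID`), which makes the second assertion a case of the first.
-/

namespace AlphaSD

variable {d : ℕ}

/-! ### Characteristic functions -/

lemma cf_zero (μ : Pr d) : cf μ 0 = 1 := by simp [cf]

lemma continuous_cf (μ : Pr d) : Continuous (cf μ) := continuous_charFun

lemma Pr_ext {μ ν : Pr d} (h : ∀ z, cf μ z = cf ν z) : μ = ν :=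
  Subtype.ext (Measure.ext_of_charFun (μ := (μ : Measure (Rd d))) (ν := (ν : Measure (Rd d)))
    (funext h))

lemma tendsto_cf {ι : Type*} {l : Filter ι} {u : ι → Pr d} {μ : Pr d} (h : Tendsto u l (𝓝 μ))
    (z : Rd d) : Tendsto (fun n => cf (u n) z) l (𝓝 (cf μ z)) := by
  rw [ProbabilityMeasure.tendsto_iff_forall_integral_rclike_tendsto ℂ] at h
  simp_rw [cf, charFun_eq_integral_innerProbChar]
  exact h (BoundedContinuousFunction.innerProbChar z)

/-- Lévy's continuity theorem, without assuming that the limit is a characteristic function. Tightness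
and Prokhorov's theorem provide a limit along an ultrafilter, whose characteristic function must
be `f`. -/
theorem exists_tendsto_of_tendsto_cf {u : ℕ → Pr d} {f : Rd d → ℂ} (hf : ContinuousAt f 0)
    (h : ∀ z, Tendsto (fun n => cf (u n) z) atTop (𝓝 (f z))) :
    ∃ μ : Pr d, (∀ z, cf μ z = f z) ∧ Tendsto u atTop (𝓝 μ) := by
  have ht : IsTightMeasureSet (Set.range fun n => (u n : Measure (Rd d))) :=
    isTightMeasureSet_of_tendsto_charFun hf h
  have hc : IsCompact (closure (Set.range u)) := by
    refine isCompact_closure_of_isTightMeasureSet ?_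
    convert ht using 1
    ext x
    simp
  obtain ⟨μ, -, hμ⟩ := hc.ultrafilter_le_nhds ((hyperfilter ℕ : Ultrafilter ℕ).map u)
    (le_principal_iff.2 (mem_map.2 (univ_mem' fun n => subset_closure ⟨n, rfl⟩)))
  have hμ' : Tendsto u (hyperfilter ℕ : Ultrafilter ℕ) (𝓝 μ) := hμ
  have hcf : ∀ z, cf μ z = f z := fun z =>
    tendsto_nhds_unique (tendsto_cf hμ' z) ((h z).mono_left Nat.hyperfilter_le_atTop)
  refine ⟨μ, hcf, ProbabilityMeasure.tendsto_of_tendsto_charFun fun z => ?_⟩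
  change Tendsto _ _ (𝓝 (cf μ z))
  rw [hcf]
  exact h z

lemma exists_conv (μ ν : Pr d) : ∃ ρ : Pr d,
    (ρ : Measure (Rd d)) = Measure.conv (μ : Measure (Rd d)) (ν : Measure (Rd d)) ∧
    ∀ z, cf ρ z = cf μ z * cf ν z :=
  ⟨⟨Measure.conv (μ : Measure (Rd d)) (ν : Measure (Rd d)), inferInstance⟩, rfl,
    fun z => charFun_conv z⟩

lemma exists_affine (μ : Pr d) (a : ℝ) (c : Rd d) : ∃ ρ : Pr d,
    (ρ : Measure (Rd d)) = Measure.map (fun x => a • x + c) (μ : Measure (Rd d)) ∧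
    ∀ z, cf ρ z = cf μ (a • z) * Complex.exp (Complex.I * (inner ℝ c z : ℝ)) := by
  refine ⟨⟨Measure.map (fun x => a • x + c) (μ : Measure (Rd d)),
    Measure.isProbabilityMeasure_map (by fun_prop)⟩, rfl, fun z => ?_⟩
  have : Measure.map (fun x => a • x + c) (μ : Measure (Rd d)) =
      Measure.map (· + c) (Measure.map (fun x => a • x) (μ : Measure (Rd d))) := by
    rw [Measure.map_map (by fun_prop) (by fun_prop)]; rfl
  change charFun (Measure.map (fun x => a • x + c) (μ : Measure (Rd d))) z = _
  rw [this, charFun_map_add_const, charFun_map_smul, mul_comm Complex.I]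
  rfl

lemma exists_npow (μ : Pr d) (n : ℕ) : ∃ ρ : Pr d,
    (ρ : Measure (Rd d)) = nConv (μ : Measure (Rd d)) n ∧ ∀ z, cf ρ z = cf μ z ^ n := by
  induction n with
  | zero =>
    refine ⟨⟨Measure.dirac 0, inferInstance⟩, rfl, fun z => ?_⟩
    simp [cf, charFun_dirac]
  | succ n ih =>
    obtain ⟨ρ, h1, h2⟩ := ih
    obtain ⟨σ, h3, h4⟩ := exists_conv ρ μ
    exact ⟨σ, by rw [h3, h1, nConv], fun z => by rw [h4, h2, pow_succ]⟩

lemma mem_ID_iff {μ : Pr d} :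
    μ ∈ ID d ↔ ∀ n : ℕ, 1 ≤ n → ∃ ν : Pr d, ∀ z, cf μ z = cf ν z ^ n := by
  refine forall₂_congr fun n _ => exists_congr fun ν => ?_
  obtain ⟨ρ, h1, h2⟩ := exists_npow ν n
  rw [← h1]
  constructor
  · intro h z
    rw [← h2, Subtype.ext h]
  · intro h
    rw [Pr_ext fun z => (h2 z).trans (h z).symm]

/-! ### Zeros of characteristic functions of infinitely divisible laws -/

/-- `‖cf μ‖ ^ 2` is the characteristic function of the symmetrization of `μ`, so the bound is the
integral of `1 - cos (2θ) ≤ 4 (1 - cos θ)`. -/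
lemma one_sub_norm_cf_two_smul_le (μ : Pr d) (z : Rd d) :
    1 - ‖cf μ ((2 : ℝ) • z)‖ ^ 2 ≤ 4 * (1 - ‖cf μ z‖ ^ 2) := by
  obtain ⟨ν, -, hν⟩ := exists_affine μ (-1) 0
  obtain ⟨τ, -, hτ⟩ := exists_conv μ ν
  have key : ∀ w, ‖cf μ w‖ ^ 2 = ∫ x, Real.cos (inner ℝ x w) ∂(τ : Measure (Rd d)) := by
    intro w
    have h1 : cf τ w = ((‖cf μ w‖ ^ 2 : ℝ) : ℂ) := by
      rw [hτ, hν, neg_one_smul]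
      simp only [cf]
      rw [charFun_neg, ← mul_assoc, Complex.mul_conj, inner_zero_left, Complex.normSq_eq_norm_sq]
      simp
    have h2 : (cf τ w).re = ∫ x, Real.cos (inner ℝ x w) ∂(τ : Measure (Rd d)) := by
      rw [cf, charFun_apply]
      have hi : Integrable (fun x : Rd d => Complex.exp ((inner ℝ x w : ℝ) * Complex.I))
          (τ : Measure (Rd d)) := by
        refine Integrable.of_bound (C := 1) (by fun_prop) (Eventually.of_forall fun x => ?_)
        rw [Complex.norm_exp_ofReal_mul_I]
      have := integral_re hi
      simp only [RCLike.re_eq_complex_re, Complex.exp_ofReal_mul_I_re] at this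
      exact this.symm
    rw [← h2, h1, Complex.ofReal_re]
  have hint : ∀ w : Rd d, Integrable (fun x : Rd d => Real.cos (inner ℝ x w))
      (τ : Measure (Rd d)) := fun w =>
    Integrable.of_bound (C := 1) (by fun_prop)
      (Eventually.of_forall fun x => by simpa using Real.abs_cos_le_one _)
  rw [key, key]
  have e : ∀ w, 1 - ∫ x, Real.cos (inner ℝ x w) ∂(τ : Measure (Rd d)) =
      ∫ x, (1 - Real.cos (inner ℝ x w)) ∂(τ : Measure (Rd d)) := fun w => by
    rw [integral_sub (integrable_const _) (hint w)]; simp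
  rw [e, e, ← integral_const_mul]
  refine integral_mono ((integrable_const _).sub (hint _))
    (((integrable_const _).sub (hint _)).const_mul _) fun x => ?_
  simp only [inner_smul_right, Real.cos_two_mul]
  nlinarith [sq_nonneg (1 - Real.cos (inner ℝ x z))]

/-- The inequality `1 - |f(2z)| ^ (2/n) ≤ 4 (1 - |f(z)| ^ (2/n))` for all `n ≥ 1`. It is
`one_sub_norm_cf_two_smul_le` for the `n`-th root of an infinitely divisible law, phrased without
mentioning the root, so that it passes to pointwise limits. -/
def DoublingBound (f : Rd d → ℂ) : Prop :=
  ∀ (n : ℕ) (z : Rd d), 1 ≤ n →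
    1 - ‖f ((2 : ℝ) • z)‖ ^ (2 / n : ℝ) ≤ 4 * (1 - ‖f z‖ ^ (2 / n : ℝ))

lemma doublingBound_of_mem_ID {μ : Pr d} (h : μ ∈ ID d) : DoublingBound (cf μ) := by
  intro n z hn
  obtain ⟨ν, hν⟩ := mem_ID_iff.1 h n hn
  have hn0 : (n : ℝ) ≠ 0 := by positivity
  have e : ∀ w, ‖cf μ w‖ ^ (2 / n : ℝ) = ‖cf ν w‖ ^ 2 := fun w => by
    rw [hν, norm_pow, ← Real.rpow_natCast, ← Real.rpow_mul (norm_nonneg _), mul_div_cancel₀ _ hn0]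
    norm_num
  rw [e, e]
  exact one_sub_norm_cf_two_smul_le ν z

lemma DoublingBound.of_tendsto {f : ℕ → Rd d → ℂ} {g : Rd d → ℂ} (hf : ∀ k, DoublingBound (f k))
    (h : ∀ z, Tendsto (fun k => f k z) atTop (𝓝 (g z))) : DoublingBound g := by
  intro n z hn
  have hlim : ∀ w, Tendsto (fun k => ‖f k w‖ ^ (2 / n : ℝ)) atTop (𝓝 (‖g w‖ ^ (2 / n : ℝ))) :=
    fun w => (h w).norm.rpow_const (Or.inr (by positivity))
  exact le_of_tendsto_of_tendsto' ((hlim _).const_sub 1) (((hlim _).const_sub 1).const_mul 4)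
    fun k => hf k n z hn

/-- If `f w ≠ 0` then `|f w| ^ (2/n) → 1`, so the bound gives `f (2w) ≠ 0`. Hence a zero `z` of `f`
would propagate to the zeros `2⁻ᵏ z`, contradicting `f 0 = 1`. -/
lemma DoublingBound.ne_zero {f : Rd d → ℂ} (hf : DoublingBound f) (hc : Continuous f)
    (h0 : f 0 = 1) (z : Rd d) : f z ≠ 0 := by
  have step : ∀ w, f ((2 : ℝ) • w) = 0 → f w = 0 := by
    intro w hw
    by_contra hne
    have hlim : Tendsto (fun n : ℕ => 4 * (1 - ‖f w‖ ^ (2 / n : ℝ))) atTop (𝓝 0) := by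
      have h1 : Tendsto (fun n : ℕ => (2 / n : ℝ)) atTop (𝓝 0) :=
        tendsto_const_div_atTop_nhds_zero_nat 2
      have h2 := (tendsto_const_nhds (x := ‖f w‖)).rpow h1 (Or.inl (norm_ne_zero_iff.2 hne))
      simpa using (h2.const_sub 1).const_mul 4
    obtain ⟨n, hn, hn1⟩ := ((hlim.eventually_lt_const one_pos).and (eventually_ge_atTop 1)).exists
    have := hf n w hn1
    rw [hw, norm_zero, Real.zero_rpow (by positivity)] at this
    linarith
  intro hz
  have hk : ∀ k : ℕ, f (((2 : ℝ)⁻¹ ^ k) • z) = 0 := by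
    intro k
    induction k with
    | zero => simpa using hz
    | succ k ih =>
      refine step _ ?_
      rw [smul_smul, pow_succ', ← mul_assoc, mul_inv_cancel₀ two_ne_zero, one_mul]
      exact ih
  have hl : Tendsto (fun k : ℕ => f (((2 : ℝ)⁻¹ ^ k) • z)) atTop (𝓝 (f ((0 : ℝ) • z))) :=
    (hc.tendsto _).comp ((tendsto_pow_atTop_nhds_zero_of_lt_one (by norm_num)
      (by norm_num)).smul_const z)
  simp only [hk, zero_smul, h0] at hl
  exact zero_ne_one (tendsto_nhds_unique tendsto_const_nhds hl)

/-! ### Cumulants -/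

lemma exists_isCumulant {μ : Pr d} (h : ∀ z, cf μ z ≠ 0) : ∃ C, IsCumulant μ C := by
  have hsc : IsSimplyConnected (Set.univ : Set (Rd d)) :=
    have := (convex_univ (𝕜 := ℝ) (E := Rd d)).contractibleSpace Set.univ_nonempty
    SimplyConnectedSpace.ofContractible _
  obtain ⟨f, hf, he⟩ := Complex.exists_continuousOn_eqOn_exp_comp (X := Rd d) (U := Set.univ)
    (g := cf μ) hsc isOpen_univ (continuous_cf μ).continuousOn
    (by simpa using h)
  have he' : ∀ z, Complex.exp (f z) = cf μ z := fun z => he (Set.mem_univ z)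
  refine ⟨fun z => f z - f 0, ?_, sub_self _, fun z => ?_⟩
  · have := continuousOn_univ.1 hf
    fun_prop
  · rw [Complex.exp_sub, he', he', cf_zero, div_one]

lemma isCumulant_cumulant_of_ne_zero {μ : Pr d} (h : ∀ z, cf μ z ≠ 0) :
    IsCumulant μ (cumulant μ) := by
  obtain ⟨C, hC⟩ := exists_isCumulant h
  rwa [cumulant_eq hC]

lemma isCumulant_cumulant {μ : Pr d} (h : μ ∈ ID d) : IsCumulant μ (cumulant μ) :=
  isCumulant_cumulant_of_ne_zero
    ((doublingBound_of_mem_ID h).ne_zero (continuous_cf μ) (cf_zero μ))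

lemma IsCumulant.ne_zero {μ : Pr d} {C : Rd d → ℂ} (h : IsCumulant μ C) (z : Rd d) :
    cf μ z ≠ 0 := by
  rw [h.2.2]; exact Complex.exp_ne_zero _

/-- If `ν` is an `n`-th root of `μ`, then `C_ν = C_μ / n`; in particular roots are unique. -/
lemma IsCumulant.root {μ ν : Pr d} {C : Rd d → ℂ} (h : IsCumulant μ C) {n : ℕ} (hn : 1 ≤ n)
    (hν : ∀ z, cf μ z = cf ν z ^ n) : IsCumulant ν (fun z => C z / n) := by
  have hD := isCumulant_cumulant_of_ne_zero (μ := ν) fun z h0 =>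
    h.ne_zero z (by rw [hν, h0, zero_pow (by lia)])
  have : IsCumulant μ (fun z => n * cumulant ν z) := by
    refine ⟨continuous_const.mul hD.1, by simp [hD.2.1], fun z => ?_⟩
    rw [hν, hD.2.2, Complex.exp_nat_mul]
  rw [← this.unique h]
  convert hD using 2 with z
  have : (n : ℂ) ≠ 0 := by exact_mod_cast (by lia : n ≠ 0)
  field_simp

/-! ### Convergence of cumulants -/

/-- The right-hand side is the integral of a bounded continuous function, so for a weakly convergent
sequence it yields equicontinuity of the characteristic functions. -/
lemma norm_cf_sub_le (μ : Pr d) {w z : Rd d} {ε : ℝ} (h : ‖w - z‖ ≤ ε) :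
    ‖cf μ w - cf μ z‖ ≤ ∫ x, min 2 (ε * ‖x‖) ∂(μ : Measure (Rd d)) := by
  have hε : 0 ≤ ε := (norm_nonneg _).trans h
  have hi : ∀ w : Rd d, Integrable (fun x : Rd d => Complex.exp ((inner ℝ x w : ℝ) * Complex.I))
      (μ : Measure (Rd d)) := fun w => by
    refine Integrable.of_bound (C := 1) (by fun_prop) (Eventually.of_forall fun x => ?_)
    rw [Complex.norm_exp_ofReal_mul_I]
  rw [cf, cf, charFun_apply, charFun_apply, ← integral_sub (hi w) (hi z)]
  refine norm_integral_le_of_norm_le ?_ (Eventually.of_forall fun x => le_min ?_ ?_)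
  · refine Integrable.of_bound (C := 2) (by fun_prop) (Eventually.of_forall fun x => ?_)
    rw [Real.norm_of_nonneg (le_min (by norm_num) (by positivity))]
    exact min_le_left _ _
  · refine (norm_sub_le _ _).trans ?_
    rw [Complex.norm_exp_ofReal_mul_I, Complex.norm_exp_ofReal_mul_I]
    norm_num
  · have e : Complex.exp ((inner ℝ x w : ℝ) * Complex.I) - Complex.exp ((inner ℝ x z : ℝ) * Complex.I)
        = Complex.exp ((inner ℝ x z : ℝ) * Complex.I) *
          (Complex.exp (Complex.I * (inner ℝ x (w - z) : ℝ)) - 1) := by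
      rw [mul_sub, ← Complex.exp_add, inner_sub_right]
      push_cast
      ring_nf
    rw [e, norm_mul, Complex.norm_exp_ofReal_mul_I, one_mul]
    refine (Real.norm_exp_I_mul_ofReal_sub_one_le).trans ?_
    refine (norm_inner_le_norm _ _).trans ?_
    rw [mul_comm]
    gcongr

/-- Weak convergence implies that characteristic functions converge continuously, i.e.
`cf (u n) w → cf μ z` as `n → ∞` and `w → z` jointly. -/
lemma tendsto_cf_prod {u : ℕ → Pr d} {μ : Pr d} (h : Tendsto u atTop (𝓝 μ)) (z : Rd d) :
    Tendsto (fun y : ℕ × Rd d => cf (u y.1) y.2) (atTop ×ˢ 𝓝 z) (𝓝 (cf μ z)) := by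
  have hsmall : Tendsto (fun k : ℕ => ∫ x, min 2 ((1 / ((k : ℝ) + 1)) * ‖x‖) ∂(μ : Measure (Rd d)))
      atTop (𝓝 0) := by
    have := tendsto_integral_of_dominated_convergence (μ := (μ : Measure (Rd d)))
      (F := fun (k : ℕ) x => min 2 ((1 / ((k : ℝ) + 1)) * ‖x‖)) (f := fun _ => 0) (fun _ => 2)
      (fun k => by fun_prop) (integrable_const _)
      (fun k => Eventually.of_forall fun x => by
        rw [Real.norm_of_nonneg (le_min (by norm_num) (by positivity))]
        exact min_le_left _ _)
      (Eventually.of_forall fun x => by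
        have h1 := (tendsto_one_div_add_atTop_nhds_zero_nat (𝕜 := ℝ)).mul_const ‖x‖
        simpa using (tendsto_const_nhds (x := (2 : ℝ))).min h1)
    simpa using this
  rw [Metric.tendsto_nhds]
  intro ε hε
  obtain ⟨k, hk⟩ := (hsmall.eventually_lt_const (half_pos hε)).exists
  have hk0 : (0 : ℝ) < 1 / ((k : ℝ) + 1) := by positivity
  -- the bounding integrand is a bounded continuous function, so its integrals converge
  let g : BoundedContinuousFunction (Rd d) ℝ :=
    BoundedContinuousFunction.ofNormedAddCommGroup
      (fun x => min 2 ((1 / ((k : ℝ) + 1)) * ‖x‖)) (by fun_prop) 2 (fun x => by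
        rw [Real.norm_of_nonneg (le_min (by norm_num) (by positivity))]
        exact min_le_left _ _)
  have hg : Tendsto (fun n => ∫ x, g x ∂(u n : Measure (Rd d))) atTop
      (𝓝 (∫ x, g x ∂(μ : Measure (Rd d)))) :=
    (ProbabilityMeasure.tendsto_iff_forall_integral_tendsto.1 h) g
  have h1 := hg.eventually_lt_const (u := ε / 2) hk
  have h2 := Metric.tendsto_nhds.1 (tendsto_cf h z) (ε / 2) (half_pos hε)
  filter_upwards [(h1.and h2).prod_mk (Metric.closedBall_mem_nhds z hk0)] with y hy
  obtain ⟨⟨hy1, hy2⟩, hy3⟩ := hy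
  have h3 := norm_cf_sub_le (u y.1) (w := y.2) (z := z) (ε := 1 / ((k : ℝ) + 1)) (by
    rw [← dist_eq_norm]; exact hy3)
  calc dist (cf (u y.1) y.2) (cf μ z)
      ≤ dist (cf (u y.1) y.2) (cf (u y.1) z) + dist (cf (u y.1) z) (cf μ z) := dist_triangle _ _ _
    _ < ε / 2 + ε / 2 := by
        refine add_lt_add_of_lt_of_lt ?_ hy2
        rw [dist_eq_norm]
        exact h3.trans_lt hy1
    _ = ε := add_halves ε

/-- Weak convergence implies that cumulants converge continuously (equivalently, locally uniformly).
On a ball around `0`, the quotient `cf (u n) / cf μ` is eventually uniformly close to `1`; its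
principal logarithm is then continuous, and differs from `C n - D` by a continuous function with
values in `2πiℤ` vanishing at `0`. -/
theorem tendsto_cumulant_prod {u : ℕ → Pr d} {μ : Pr d} {C : ℕ → Rd d → ℂ} {D : Rd d → ℂ}
    (h : Tendsto u atTop (𝓝 μ)) (hC : ∀ᶠ n in atTop, IsCumulant (u n) (C n)) (hD : IsCumulant μ D)
    (z : Rd d) :
    Tendsto (fun y : ℕ × Rd d => C y.1 y.2) (atTop ×ˢ 𝓝 z) (𝓝 (D z)) := by
  set F : ℕ → Rd d → ℂ := fun n w => cf (u n) w / cf μ w with hF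
  have hlim : ∀ w, Tendsto (fun y : ℕ × Rd d => F y.1 y.2) (atTop ×ˢ 𝓝 w) (𝓝 1) := fun w => by
    have := (tendsto_cf_prod h w).div
      (((continuous_cf μ).tendsto w).comp (tendsto_snd (f := (atTop : Filter ℕ)))) (hD.ne_zero w)
    rwa [div_self (hD.ne_zero w)] at this
  have hloc : TendstoLocallyUniformly F (fun _ => 1) atTop := by
    rw [tendstoLocallyUniformly_iff_forall_tendsto]
    intro w
    rw [tendsto_uniformity_iff_dist_tendsto_zero]
    simpa [dist_comm] using tendsto_iff_dist_tendsto_zero.1 (hlim w)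
  set K : Set (Rd d) := Metric.closedBall 0 (‖z‖ + 1) with hK
  have hunif : TendstoUniformlyOn F (fun _ => 1) atTop K :=
    (tendstoLocallyUniformlyOn_iff_tendstoUniformlyOn_of_compact (isCompact_closedBall _ _)).1
      hloc.tendstoLocallyUniformlyOn
  have hev := Metric.tendstoUniformlyOn_iff.1 hunif 1 one_pos
  have hlog : ∀ᶠ n in atTop, ∀ w ∈ K, C n w = D w + Complex.log (F n w) := by
    filter_upwards [hev, hC] with n hn hCn
    have hslit : ∀ w ∈ K, F n w ∈ Complex.slitPlane := fun w hw =>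
      Complex.ball_one_subset_slitPlane (by simpa [dist_comm] using hn w hw)
    have hFc : Continuous (F n) :=
      (continuous_cf _).div (continuous_cf _) hD.ne_zero
    have hFe : ∀ w, F n w ≠ 0 := fun w => div_ne_zero (hCn.ne_zero w) (hD.ne_zero w)
    have h2 : ∀ w, ∃ m : ℤ, C n w - D w - Complex.log (F n w) = m * (2 * Real.pi * Complex.I) :=
      fun w => by
        rw [← Complex.exp_eq_one_iff, Complex.exp_sub, Complex.exp_sub, ← hCn.2.2, ← hD.2.2,
          Complex.exp_log (hFe w)]
        exact div_self (hFe w)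
    choose m hm using h2
    have hc : ContinuousOn (fun w => ((m w : ℤ) : ℝ)) K := by
      have : (fun w => ((m w : ℤ) : ℝ)) =
          fun w => ((C n w - D w - Complex.log (F n w)) / (2 * Real.pi * Complex.I)).re := by
        funext w
        rw [hm w, mul_div_assoc, div_self Complex.two_pi_I_ne_zero]
        simp
      rw [this]
      refine Complex.continuous_re.comp_continuousOn (ContinuousOn.div_const ?_ _)
      exact (hCn.1.sub hD.1).continuousOn.sub (hFc.continuousOn.clog hslit)
    have hc' : ContinuousOn m K := Int.isClosedEmbedding_coe_real.isEmbedding.continuousOn_iff.2 hc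
    intro w hw
    have h0 : m w = m 0 := (convex_closedBall _ _).isPreconnected.constant hc' hw
      (Metric.mem_closedBall_self (by positivity))
    have h00 := hm 0
    have hF0 : F n 0 = 1 := by simp [hF, cf_zero]
    rw [← h0, ← hm w, hCn.2.1, hD.2.1, hF0, Complex.log_one, sub_self, sub_zero] at h00
    linear_combination -h00
  have hKz : K ∈ 𝓝 z := Metric.closedBall_mem_nhds_of_mem (by simp)
  have hfin : Tendsto (fun y : ℕ × Rd d => D y.2 + Complex.log (F y.1 y.2)) (atTop ×ˢ 𝓝 z)
      (𝓝 (D z)) := by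
    have := ((hD.1.tendsto z).comp (tendsto_snd (f := (atTop : Filter ℕ)))).add
      ((hlim z).clog Complex.one_mem_slitPlane)
    simpa using this
  refine hfin.congr' ?_
  filter_upwards [hlog.prod_mk hKz] with y hy
  exact (hy.1 _ hy.2).symm

/-! ### Closure properties of the class of infinitely divisible laws -/

theorem mem_ID_of_tendsto {u : ℕ → Pr d} {μ : Pr d} (hu : ∀ n, u n ∈ ID d)
    (h : Tendsto u atTop (𝓝 μ)) : μ ∈ ID d := by
  have hD := isCumulant_cumulant_of_ne_zero
    ((DoublingBound.of_tendsto (fun k => doublingBound_of_mem_ID (hu k)) (tendsto_cf h)).ne_zero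
      (continuous_cf μ) (cf_zero μ))
  refine mem_ID_iff.2 fun n hn => ?_
  choose ν hν using fun k => mem_ID_iff.1 (hu k) n hn
  have hroot := fun k => (isCumulant_cumulant (hu k)).root hn (hν k)
  have hDc := hD.1
  obtain ⟨σ, hσ, -⟩ := exists_tendsto_of_tendsto_cf (u := ν)
    (f := fun z => Complex.exp (cumulant μ z / n)) (by fun_prop) fun z => by
      simp only [(hroot _).2.2]
      refine (Complex.continuous_exp.tendsto _).comp (Tendsto.div_const ?_ _)
      exact (tendsto_cumulant_prod h (Eventually.of_forall fun k => isCumulant_cumulant (hu k)) hD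
        z).comp (tendsto_id.prodMk tendsto_const_nhds)
  refine ⟨σ, fun z => ?_⟩
  have hn0 : (n : ℂ) ≠ 0 := by exact_mod_cast (by lia : n ≠ 0)
  rw [hσ, ← Complex.exp_nat_mul, mul_div_cancel₀ _ hn0, hD.2.2]

/-- The `t`-th convolution is the weak limit of the `⌊t k⌋`-fold convolutions of the `k`-th roots. -/
lemma exists_isConvPow {μ : Pr d} (h : μ ∈ ID d) {t : ℝ} (ht : 0 ≤ t) :
    ∃ ν : Pr d, IsConvPow μ t ν := by
  have hC := isCumulant_cumulant h
  have hCc := hC.1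
  -- `ν k` is the root of order `k + 1`, and `ρ k` its convolution power of order `⌊t (k + 1)⌋`
  choose ν hν using fun k : ℕ => mem_ID_iff.1 h (k + 1) (by lia)
  have hroot := fun k => hC.root (by lia) (hν k)
  choose ρ _ hρ using fun k : ℕ => exists_npow (ν k) ⌊t * ((k + 1 : ℕ) : ℝ)⌋₊
  obtain ⟨σ, hσ, -⟩ := exists_tendsto_of_tendsto_cf (u := ρ) (f := cfPow μ t)
    (by unfold cfPow; fun_prop) fun z => by
      have e : ∀ k : ℕ, cf (ρ k) z = Complex.exp (((⌊t * ((k + 1 : ℕ) : ℝ)⌋₊ / ((k + 1 : ℕ) : ℝ) : ℝ) : ℂ)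
          * cumulant μ z) := fun k => by
        rw [hρ, (hroot k).2.2, ← Complex.exp_nat_mul]
        congr 1
        push_cast
        ring
      simp only [e]
      refine (Complex.continuous_exp.tendsto _).comp (Tendsto.mul_const _ ?_)
      refine (Complex.continuous_ofReal.tendsto _).comp ?_
      exact (tendsto_nat_floor_mul_div_atTop ht).comp
        (tendsto_natCast_atTop_atTop.comp (tendsto_add_atTop_nat 1))
  exact ⟨σ, hσ⟩

lemma ccss_ID : CCSS (ID d) where
  subset_ID := subset_rfl
  conv_mem μ hμ ν hν ρ hρ := by
    refine mem_ID_iff.2 fun n hn => ?_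
    obtain ⟨μ', h1⟩ := mem_ID_iff.1 hμ n hn
    obtain ⟨ν', h2⟩ := mem_ID_iff.1 hν n hn
    obtain ⟨τ, h3, h4⟩ := exists_conv μ ν
    obtain ⟨σ, -, h5⟩ := exists_conv μ' ν'
    refine ⟨σ, fun z => ?_⟩
    rw [Subtype.ext (hρ.trans h3.symm), h4, h5, h1, h2, mul_pow]
  lim_mem u μ hu h := mem_ID_of_tendsto hu h
  type_mem μ hμ a c _ ρ hρ := by
    refine mem_ID_iff.2 fun n hn => ?_
    obtain ⟨μ', h1⟩ := mem_ID_iff.1 hμ n hn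
    obtain ⟨τ, h3, h4⟩ := exists_affine μ a c
    obtain ⟨σ, -, h5⟩ := exists_affine μ' a ((n : ℝ)⁻¹ • c)
    refine ⟨σ, fun z => ?_⟩
    have hn0 : (n : ℂ) ≠ 0 := by exact_mod_cast (by lia : n ≠ 0)
    rw [Subtype.ext (hρ.trans h3.symm), h4, h5, h1, mul_pow, ← Complex.exp_nat_mul,
      real_inner_smul_left]
    congr 2
    push_cast
    field_simp
  convPow_mem μ hμ t ht ρ hρ := by
    refine mem_ID_iff.2 fun n hn => ?_
    obtain ⟨σ, hσ⟩ := exists_isConvPow hμ (t := t / n) (by positivity)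
    refine ⟨σ, fun z => ?_⟩
    have hn0 : (n : ℂ) ≠ 0 := by exact_mod_cast (by lia : n ≠ 0)
    rw [hσ, hρ, cfPow, cfPow, ← Complex.exp_nat_mul]
    congr 1
    push_cast
    field_simp

/-! ### Products of powers within a completely closed class -/

lemma CCSS.mem_of_cf_eq_mul {H : Set (Pr d)} (hH : CCSS H) {μ ν ρ : Pr d} (hμ : μ ∈ H)
    (hν : ν ∈ H) (h : ∀ z, cf ρ z = cf μ z * cf ν z) : ρ ∈ H := by
  obtain ⟨τ, h1, h2⟩ := exists_conv μ ν
  rw [Pr_ext fun z => (h z).trans (h2 z).symm]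
  exact hH.conv_mem μ hμ ν hν τ h1

lemma CCSS.exists_affine_mem {H : Set (Pr d)} (hH : CCSS H) {μ : Pr d} (hμ : μ ∈ H) {a : ℝ}
    (ha : 0 < a) (c : Rd d) :
    ∃ ρ ∈ H, ∀ z, cf ρ z = cf μ (a • z) * Complex.exp (Complex.I * (inner ℝ c z : ℝ)) := by
  obtain ⟨τ, h1, h2⟩ := exists_affine μ a c
  exact ⟨τ, hH.type_mem μ hμ a c ha τ h1, h2⟩

lemma CCSS.exists_isConvPow_mem {H : Set (Pr d)} (hH : CCSS H) {μ : Pr d} (hμ : μ ∈ H) {t : ℝ}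
    (ht : 0 < t) : ∃ ρ ∈ H, IsConvPow μ t ρ := by
  obtain ⟨ρ, hρ⟩ := exists_isConvPow (hH.subset_ID hμ) ht.le
  exact ⟨ρ, hH.convPow_mem μ hμ t ht ρ hρ, hρ⟩

lemma CCSS.exists_block_mem {H : Set (Pr d)} (hH : CCSS H) {u : ℕ → Pr d} {n m : ℕ} (hnm : n < m)
    (hu : ∀ j, n < j → u j ∈ H) {p a : ℝ} (hp : 0 < p) (ha : 0 < a) (c : Rd d) :
    ∃ ρ ∈ H, ∀ z, cf ρ z = (∏ j ∈ Finset.Ioc n m, cfPow (u j) p (a • z)) *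
      Complex.exp (Complex.I * (inner ℝ c z : ℝ)) := by
  have key : ∃ ρ ∈ H, ∀ z, cf ρ z = ∏ j ∈ Finset.Ioc n m, cfPow (u j) p z := by
    induction m, hnm using Nat.le_induction with
    | base =>
      obtain ⟨ρ, h1, h2⟩ := hH.exists_isConvPow_mem (hu (n + 1) n.lt_succ_self) hp
      exact ⟨ρ, h1, fun z => by simp [h2 z]⟩
    | succ m hm ih =>
      obtain ⟨ρ, h1, h2⟩ := ih
      obtain ⟨σ, h3, h4⟩ := hH.exists_isConvPow_mem (hu (m + 1) (by lia)) hp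
      obtain ⟨τ, -, h5⟩ := exists_conv ρ σ
      refine ⟨τ, hH.mem_of_cf_eq_mul h1 h3 h5, fun z => ?_⟩
      rw [h5, h2, h4, Finset.prod_Ioc_succ_top (by lia)]
  obtain ⟨ρ, h1, h2⟩ := key
  obtain ⟨σ, h3, h4⟩ := hH.exists_affine_mem h1 ha c
  exact ⟨σ, h3, fun z => by rw [h4, h2]⟩

lemma prod_cfPow (s : Finset ℕ) (u : ℕ → Pr d) (t : ℝ) (z : Rd d) :
    ∏ j ∈ s, cfPow (u j) t z = Complex.exp (t * ∑ j ∈ s, cumulant (u j) z) := by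
  simp only [cfPow, ← Complex.exp_sum, Finset.mul_sum]

/-! ### Limits of normalized partial products -/

/-- With `m n` the least index above `n` such that `b * a n ≤ a (m n)`, minimality gives
`b ≤ a (m n) / a n ≤ b * (a (m n) / a (m n - 1))`. -/
lemma exists_index_ratio_tendsto {a : ℕ → ℝ} (hpos : ∀ n, 1 ≤ n → 0 < a n)
    (htop : Tendsto a atTop atTop) (hratio : Tendsto (fun n => a (n + 1) / a n) atTop (𝓝 1))
    {b : ℝ} (hb : 1 < b) :
    ∃ m : ℕ → ℕ, (∀ n, n < m n) ∧ Tendsto (fun n => a (m n) / a n) atTop (𝓝 b) := by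
  have hex : ∀ n, ∃ k, n ≤ k ∧ (1 ≤ n → a k < b * a n ∧ b * a n ≤ a (k + 1)) := by
    intro n
    rcases Nat.eq_zero_or_pos n with rfl | hn
    · exact ⟨0, le_rfl, by simp⟩
    have hex' : ∃ k, n ≤ k ∧ b * a n ≤ a (k + 1) := by
      obtain ⟨k, hk1, hk2⟩ := (((tendsto_add_atTop_iff_nat 1).2 htop).eventually_ge_atTop
        (b * a n) |>.and (eventually_ge_atTop n)).exists
      exact ⟨k, hk2, hk1⟩
    classical
    obtain ⟨h1, h2⟩ := Nat.find_spec hex'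
    refine ⟨Nat.find hex', h1, fun _ => ⟨?_, h2⟩⟩
    rcases h1.eq_or_lt with h | h
    · rw [← h]
      nlinarith [hpos n hn]
    · obtain ⟨k, hk⟩ : ∃ k, Nat.find hex' = k + 1 := ⟨Nat.find hex' - 1, by lia⟩
      by_contra! hlt
      exact Nat.find_min hex' (m := k) (by lia) ⟨by lia, by rwa [hk] at hlt⟩
  choose k hk hk' using hex
  refine ⟨fun n => k n + 1, fun n => Nat.lt_succ_of_le (hk n), ?_⟩
  have hktop : Tendsto k atTop atTop := tendsto_atTop_mono hk tendsto_id
  have hup : Tendsto (fun n => b * (a (k n + 1) / a (k n))) atTop (𝓝 b) := by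
    simpa using (hratio.comp hktop).const_mul b
  refine tendsto_of_tendsto_of_tendsto_of_le_of_le' tendsto_const_nhds hup ?_ ?_
  · filter_upwards [eventually_ge_atTop 1] with n hn
    rw [le_div_iff₀ (hpos n hn)]
    exact (hk' n hn).2
  · filter_upwards [eventually_ge_atTop 1] with n hn
    have h1 := hpos n hn
    have h2 := hpos (k n) (hn.trans (hk n))
    have h3 := hpos (k n + 1) (by lia)
    rw [mul_div_assoc', div_le_div_iff₀ h1 h2]
    nlinarith [(hk' n hn).1]

lemma tendsto_ratio_rpow {α b : ℝ} (hb : 0 < b) {a p : ℕ → ℝ} (ha : ∀ n, 1 ≤ n → 0 < a n)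
    (hpa : Tendsto (fun n => p n / a n ^ α) atTop (𝓝 1)) {m : ℕ → ℕ} (hm : ∀ n, n < m n)
    (hr : Tendsto (fun n => a (m n) / a n) atTop (𝓝 b)) :
    Tendsto (fun n => p (m n) / p n) atTop (𝓝 (b ^ α)) := by
  have hmtop : Tendsto m atTop atTop := tendsto_atTop_mono (fun n => (hm n).le) tendsto_id
  have h := ((hpa.comp hmtop).div hpa one_ne_zero).mul (hr.rpow_const (p := α) (Or.inl hb.ne'))
  rw [div_one, one_mul] at h
  refine h.congr' ?_
  filter_upwards [eventually_ge_atTop 1] with n hn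
  have h1 := ha n hn
  have h2 := ha (m n) (by have := hm n; lia)
  simp only [Function.comp_apply, Pi.div_apply]
  rw [Real.div_rpow h2.le h1.le]
  have h3 := (Real.rpow_pos_of_pos h1 α).ne'
  have h4 := (Real.rpow_pos_of_pos h2 α).ne'
  by_cases h5 : p n = 0
  · simp [h5]
  field_simp

/-- The cumulant `p_n ∑_{1 ≤ j ≤ n} C_{u_j}(a_n⁻¹ z) + i ⟨c_n, z⟩` of the `n`-th normalized partial
product. -/
noncomputable def partialCumulant (u : ℕ → Pr d) (a p : ℕ → ℝ) (c : ℕ → Rd d) (n : ℕ) (z : Rd d) : ℂ :=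
  p n * ∑ j ∈ Finset.Icc 1 n, cumulant (u j) ((a n)⁻¹ • z) + Complex.I * (inner ℝ (c n) z : ℝ)

lemma exp_partialCumulant (u : ℕ → Pr d) (a p : ℕ → ℝ) (c : ℕ → Rd d) (n : ℕ) (z : Rd d) :
    Complex.exp (partialCumulant u a p c n z) =
      (∏ j ∈ Finset.Icc 1 n, cfPow (u j) (p n) ((a n)⁻¹ • z)) *
        Complex.exp (Complex.I * (inner ℝ (c n) z : ℝ)) := by
  rw [prod_cfPow, ← Complex.exp_add, partialCumulant]

lemma isCumulant_partialCumulant {u : ℕ → Pr d} (hu : ∀ j, 1 ≤ j → u j ∈ ID d) (a p : ℕ → ℝ)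
    (c : ℕ → Rd d) (n : ℕ) {v : Pr d}
    (hv : ∀ z, cf v z = Complex.exp (partialCumulant u a p c n z)) :
    IsCumulant v (partialCumulant u a p c n) := by
  have hC : ∀ j ∈ Finset.Icc 1 n, IsCumulant (u j) (cumulant (u j)) := fun j hj =>
    isCumulant_cumulant (hu j (Finset.mem_Icc.1 hj).1)
  refine ⟨?_, ?_, hv⟩
  · have := continuous_finsetSum (Finset.Icc 1 n) (f := fun j z => cumulant (u j) ((a n)⁻¹ • z))
      fun j hj => (hC j hj).1.comp (continuous_const_smul _)
    unfold partialCumulant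
    fun_prop
  · simp only [partialCumulant, smul_zero, inner_zero_right, Complex.ofReal_zero, mul_zero,
      add_zero]
    rw [Finset.sum_eq_zero fun j hj => (hC j hj).2.1, mul_zero]

/-- After rescaling, the terms with indices up to `n` cancel in the difference, and the drift is the
only other remainder. -/
lemma partialCumulant_sub (u : ℕ → Pr d) {a p : ℕ → ℝ} (c : ℕ → Rd d) {n m : ℕ} (hnm : n ≤ m)
    (ha : a n ≠ 0) (hp : p n ≠ 0) (z : Rd d) :
    partialCumulant u a p c m z -
        ((p m / p n : ℝ) : ℂ) * partialCumulant u a p c n ((a n / a m) • z) =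
      p m * ∑ j ∈ Finset.Ioc n m, cumulant (u j) ((a m)⁻¹ • z) +
        Complex.I * (inner ℝ (c m - (p m / p n * (a n / a m)) • c n) z : ℝ) := by
  have hsplit : ∑ j ∈ Finset.Icc 1 m, cumulant (u j) ((a m)⁻¹ • z) =
      ∑ j ∈ Finset.Icc 1 n, cumulant (u j) ((a m)⁻¹ • z) +
        ∑ j ∈ Finset.Ioc n m, cumulant (u j) ((a m)⁻¹ • z) :=
    (Finset.sum_Ioc_consecutive _ (Nat.zero_le n) hnm).symm
  have hscale : (a n)⁻¹ • (a n / a m) • z = (a m)⁻¹ • z := by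
    rw [smul_smul]
    congr 1
    field_simp
  have hp' : ((p m / p n : ℝ) : ℂ) * p n = p m := by
    rw [← Complex.ofReal_mul, div_mul_cancel₀ _ hp]
  rw [partialCumulant, partialCumulant, hsplit, hscale, inner_sub_left, real_inner_smul_left,
    real_inner_smul_right, Complex.ofReal_sub, Complex.ofReal_mul (p m / p n * (a n / a m)),
    Complex.ofReal_mul (p m / p n), Complex.ofReal_mul (a n / a m), ← hp']
  ring

lemma tendsto_exp_sub_mul {G : ℕ → Rd d → ℂ} {g : Rd d → ℂ}
    (h : ∀ z, Tendsto (fun y : ℕ × Rd d => G y.1 y.2) (atTop ×ˢ 𝓝 z) (𝓝 (g z)))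
    {m : ℕ → ℕ} (hm : Tendsto m atTop atTop) {q r : ℕ → ℝ} {q₀ r₀ : ℝ}
    (hq : Tendsto q atTop (𝓝 q₀)) (hr : Tendsto r atTop (𝓝 r₀)) (z : Rd d) :
    Tendsto (fun n => Complex.exp (G (m n) z - (q n : ℂ) * G n (r n • z))) atTop
      (𝓝 (Complex.exp (g z - (q₀ : ℂ) * g (r₀ • z)))) := by
  have h1 : Tendsto (fun n => G (m n) z) atTop (𝓝 (g z)) :=
    (h z).comp (hm.prodMk tendsto_const_nhds)
  have h2 : Tendsto (fun n => G n (r n • z)) atTop (𝓝 (g (r₀ • z))) :=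
    (h (r₀ • z)).comp (tendsto_id.prodMk (hr.smul_const z))
  have h3 : Tendsto (fun n => (q n : ℂ)) atTop (𝓝 (q₀ : ℂ)) :=
    (Complex.continuous_ofReal.tendsto _).comp hq
  exact (h1.sub (h3.mul h2)).cexp

theorem mem_ID_and_decomp_of_mem_Q {α : ℝ} {H : Set (Pr d)} (hH : CCSS H) {μ : Pr d}
    (hμ : μ ∈ Q α H) :
    μ ∈ ID d ∧ ∀ b : ℝ, 1 < b → ∃ ρ ∈ H, Decomp α b μ ρ := by
  obtain ⟨u, a, p, c, huI, ⟨j₀, hj₀, huH⟩, ha, -, hatop, haratio, hp, hpa, hlim⟩ := hμ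
  -- the laws of the normalized partial products; there is no constraint at the unused index `0`
  have hv : ∀ n, ∃ v ∈ ID d, 1 ≤ n → ∀ z, cf v z = Complex.exp (partialCumulant u a p c n z) := by
    intro n
    rcases Nat.eq_zero_or_pos n with rfl | hn
    · exact ⟨u 1, huI 1 le_rfl, by simp⟩
    obtain ⟨v, h1, h2⟩ := ccss_ID.exists_block_mem hn (fun j hj => huI j hj) (hp n hn)
      (inv_pos.2 (ha n hn)) (c n)
    exact ⟨v, h1, fun _ z => (h2 z).trans (exp_partialCumulant u a p c n z).symm⟩
  choose v hvI hvcf using hv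
  have hvlim : Tendsto v atTop (𝓝 μ) := by
    refine ProbabilityMeasure.tendsto_of_tendsto_charFun fun z => (hlim z).congr' ?_
    filter_upwards [eventually_ge_atTop 1] with n hn
    rw [← exp_partialCumulant, ← hvcf n hn, cf]
  have hμI : μ ∈ ID d := mem_ID_of_tendsto hvI hvlim
  refine ⟨hμI, fun b hb => ?_⟩
  have hb0 : 0 < b := one_pos.trans hb
  have hC := isCumulant_cumulant hμI
  have hcc : Continuous (cumulant μ) := hC.1
  have hΓlim := tendsto_cumulant_prod hvlim ((eventually_ge_atTop 1).mono fun n hn =>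
    isCumulant_partialCumulant huI a p c n (hvcf n hn)) hC
  obtain ⟨m, hm, hr⟩ := exists_index_ratio_tendsto ha hatop haratio hb
  have hmtop : Tendsto m atTop atTop := tendsto_atTop_mono (fun n => (hm n).le) tendsto_id
  have hpr := tendsto_ratio_rpow hb0 ha hpa hm hr
  have hrinv : Tendsto (fun n => a n / a (m n)) atTop (𝓝 b⁻¹) := by
    simpa using hr.inv₀ hb0.ne'
  -- the law of the block of factors with indices in `(n, m n]`, recentred, belongs to `H`
  have hblock : ∀ n, j₀ ≤ n → ∃ ρ ∈ H, ∀ z, cf ρ z = Complex.exp (partialCumulant u a p c (m n) z -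
      ((p (m n) / p n : ℝ) : ℂ) * partialCumulant u a p c n ((a n / a (m n)) • z)) := by
    intro n hn
    have hn1 : 1 ≤ n := hj₀.trans hn
    have hm1 : 1 ≤ m n := hn1.trans (hm n).le
    obtain ⟨ρ, h1, h2⟩ := hH.exists_block_mem (hm n) (fun j hj => huH j (hn.trans hj.le))
      (hp _ hm1) (inv_pos.2 (ha _ hm1)) (c (m n) - (p (m n) / p n * (a n / a (m n))) • c n)
    refine ⟨ρ, h1, fun z => ?_⟩
    rw [h2, prod_cfPow, ← Complex.exp_add,
      partialCumulant_sub u c (hm n).le (ha n hn1).ne' (hp n hn1).ne']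
  choose! ρ hρH hρcf using hblock
  have hlimρ : ∀ z, Tendsto (fun k => cf (ρ (k + j₀)) z) atTop
      (𝓝 (Complex.exp (cumulant μ z - ((b ^ α : ℝ) : ℂ) * cumulant μ (b⁻¹ • z)))) := by
    intro z
    refine ((tendsto_exp_sub_mul hΓlim hmtop hpr hrinv z).comp
      (tendsto_add_atTop_nat j₀)).congr fun k => ?_
    exact (hρcf (k + j₀) (Nat.le_add_left _ _) z).symm
  obtain ⟨σ, hσ, hσlim⟩ := exists_tendsto_of_tendsto_cf (Continuous.continuousAt (by fun_prop))
    hlimρ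
  refine ⟨σ, hH.lim_mem _ σ (fun k => hρH _ (Nat.le_add_left _ _)) hσlim, fun z => ?_⟩
  rw [hσ, cfPow, ← Complex.exp_add, hC.2.2]
  congr 1
  ring

/-! ### Decomposable laws as limits -/

lemma Decomp.cumulant_eq {α b : ℝ} {μ ρ : Pr d} (hμ : μ ∈ ID d) (hρ : ρ ∈ ID d)
    (h : Decomp α b μ ρ) (z : Rd d) :
    cumulant ρ z = cumulant μ z - ((b ^ α : ℝ) : ℂ) * cumulant μ (b⁻¹ • z) := by
  have hC := isCumulant_cumulant hμ
  have hcc : Continuous (cumulant μ) := hC.1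
  have : IsCumulant ρ fun z => cumulant μ z - ((b ^ α : ℝ) : ℂ) * cumulant μ (b⁻¹ • z) := by
    refine ⟨by fun_prop, by simp [hC.2.1], fun z => ?_⟩
    have := h z
    rw [Complex.exp_sub, ← hC.2.2, this, cfPow, mul_div_cancel_left₀ _ (Complex.exp_ne_zero _)]
  exact congrFun ((isCumulant_cumulant hρ).unique this) z

theorem mem_Q_of_decomp {α : ℝ} {H : Set (Pr d)} (hH : CCSS H) {μ : Pr d} (hμ : μ ∈ ID d)
    (h : ∀ b : ℝ, 1 < b → ∃ ρ ∈ H, Decomp α b μ ρ) : μ ∈ Q α H := by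
  have hC := isCumulant_cumulant hμ
  set D : ℕ → Rd d → ℂ := fun j w => (((j : ℝ) ^ (-α) : ℝ) : ℂ) * cumulant μ ((j : ℝ) • w) with hD
  -- with `b = j / (j - 1)`, the increment is `j ^ (-α) * cumulant ρ (j w)`
  have hinc : ∀ j : ℕ, 2 ≤ j → ∃ ν ∈ H, ∀ w, cumulant ν w = D j w - D (j - 1) w := by
    intro j hj
    obtain ⟨i, rfl⟩ : ∃ i, j = i + 1 := ⟨j - 1, by lia⟩
    have hi : (0 : ℝ) < i := by exact_mod_cast (by lia : 0 < i)
    have hj0 : (0 : ℝ) < ((i + 1 : ℕ) : ℝ) := by positivity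
    obtain ⟨ρ, h1, h2⟩ := h (((i + 1 : ℕ) : ℝ) / i) (by rw [one_lt_div hi]; push_cast; linarith)
    have hρ := h2.cumulant_eq hμ (hH.subset_ID h1)
    obtain ⟨σ, h3, h4⟩ := hH.exists_isConvPow_mem h1 (t := ((i + 1 : ℕ) : ℝ) ^ (-α)) (by positivity)
    obtain ⟨ν, h5, h6⟩ := hH.exists_affine_mem h3 hj0 0
    have hcr := isCumulant_cumulant (hH.subset_ID h1)
    have hcrc : Continuous (cumulant ρ) := hcr.1
    have hν : IsCumulant ν fun w => ((((i + 1 : ℕ) : ℝ) ^ (-α) : ℝ) : ℂ) *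
        cumulant ρ (((i + 1 : ℕ) : ℝ) • w) := by
      refine ⟨by fun_prop, by simp [hcr.2.1], fun w => ?_⟩
      rw [h6, h4, cfPow]
      simp
    refine ⟨ν, h5, fun w => ?_⟩
    rw [AlphaSD.cumulant_eq hν]
    have e1 : ((((i + 1 : ℕ) : ℝ) / i)⁻¹) • (((i + 1 : ℕ) : ℝ) • w) = (i : ℝ) • w := by
      rw [smul_smul]
      congr 1
      field_simp
    have e2 : ((i + 1 : ℕ) : ℝ) ^ (-α) * (((i + 1 : ℕ) : ℝ) / i) ^ α = (i : ℝ) ^ (-α) := by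
      rw [Real.div_rpow hj0.le hi.le, Real.rpow_neg hj0.le, Real.rpow_neg hi.le]
      have := (Real.rpow_pos_of_pos hj0 α).ne'
      field_simp
    simp only [hD, Nat.add_sub_cancel, hρ, e1, ← e2]
    push_cast
    ring
  choose! ν hνH hνc using hinc
  -- only the first factor, whose cumulant is `D 1 = cumulant μ`, may lie outside `H`
  set u : ℕ → Pr d := fun j => if 2 ≤ j then ν j else μ with hu
  have hsum : ∀ n, 1 ≤ n → ∀ w, ∑ j ∈ Finset.Icc 1 n, cumulant (u j) w = D n w := by
    intro n hn w
    induction n, hn using Nat.le_induction with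
    | base => simp [hu, hD]
    | succ n hn ih =>
      rw [Finset.sum_Icc_succ_top (by lia), ih]
      simp only [hu, if_pos (show 2 ≤ n + 1 by lia), hνc (n + 1) (by lia), Nat.add_sub_cancel]
      ring
  refine ⟨u, fun n => n, fun n => (n : ℝ) ^ α, fun _ => 0, fun j _ => ?_, ⟨2, by lia, fun j hj => ?_⟩,
    fun n hn => ?_, fun i _ j _ hij => ?_, tendsto_natCast_atTop_atTop, ?_, fun n hn => ?_, ?_,
    fun z => ?_⟩
  · by_cases hj : 2 ≤ j
    · simpa [hu, hj] using hH.subset_ID (hνH j hj)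
    · simpa [hu, hj] using hμ
  · simpa [hu, hj] using hνH j hj
  · exact Nat.cast_pos.2 hn
  · exact Nat.cast_le.2 hij
  · have h1 : Tendsto (fun n : ℕ => 1 + 1 / (n : ℝ)) atTop (𝓝 1) := by
      simpa using (tendsto_one_div_atTop_nhds_zero_nat (𝕜 := ℝ)).const_add 1
    refine h1.congr' ?_
    filter_upwards [eventually_ge_atTop 1] with n hn
    have : (n : ℝ) ≠ 0 := by positivity
    push_cast
    field_simp
  · have : (0 : ℝ) < n := by exact_mod_cast hn
    positivity
  · refine tendsto_const_nhds.congr' ?_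
    filter_upwards [eventually_ge_atTop 1] with n hn
    have : (0 : ℝ) < n := by exact_mod_cast hn
    exact (div_self (by positivity)).symm
  · refine tendsto_const_nhds.congr' ?_
    filter_upwards [eventually_ge_atTop 1] with n hn
    have hn0 : (0 : ℝ) < n := by exact_mod_cast hn
    rw [prod_cfPow, hsum n hn]
    have e : (n : ℝ) ^ α * (n : ℝ) ^ (-α) = 1 := by
      rw [← Real.rpow_add hn0, add_neg_cancel, Real.rpow_zero]
    simp only [hD, smul_smul, mul_inv_cancel₀ hn0.ne', one_smul, inner_zero_left,
      Complex.ofReal_zero, mul_zero, Complex.exp_zero, mul_one]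
    rw [← mul_assoc, ← Complex.ofReal_mul, e, Complex.ofReal_one, one_mul, hC.2.2]

end AlphaSD

theorem theorem3p2 (d : ℕ) (α : ℝ) :
    (∀ H : Set (AlphaSD.Pr d), AlphaSD.CCSS H →
      ∀ μ : AlphaSD.Pr d, μ ∈ AlphaSD.Q α H ↔
        μ ∈ AlphaSD.ID d ∧ ∀ b : ℝ, 1 < b → ∃ ρ ∈ H, AlphaSD.Decomp α b μ ρ) ∧
    AlphaSD.Q α (AlphaSD.ID d) = AlphaSD.L d α := by
  have key : ∀ H : Set (AlphaSD.Pr d), AlphaSD.CCSS H →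
      ∀ μ : AlphaSD.Pr d, μ ∈ AlphaSD.Q α H ↔
        μ ∈ AlphaSD.ID d ∧ ∀ b : ℝ, 1 < b → ∃ ρ ∈ H, AlphaSD.Decomp α b μ ρ := fun H hH μ =>
    ⟨AlphaSD.mem_ID_and_decomp_of_mem_Q hH, fun h => AlphaSD.mem_Q_of_decomp hH h.1 h.2⟩
  exact ⟨key, Set.ext (key _ AlphaSD.ccss_ID)⟩
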